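/- All graphs are finite and simple. A \emph{convex drawing} of a graph places its vertices on different points of a circle in the Euclidean plane and draws every edge as the straight-line segment between its endpoints. Two different edges \emph{cross} in such a drawing if their segments have a common interior point. A graph is \emph{outer $2$-planar} if it admits a convex drawing in which every edge crosses at most two other edges. A \emph{tree decomposition} of a graph $G$ is a finite tree whose nodes carry sets of vertices of $G$ (\emph{bags}) such that every vertex and every edge of $G$ is contained in some bag and, for every vertex $v$, the nodes whose bags contain $v$ induce a subtree. Its \emph{width} is the maximum size of a bag minus one, and the \emph{treewidth} $\operatorname{tw}(G)$ is the minimum width over all tree decompositions of $G$. \textbf{Theorem.} Every outer $2$-planar graph $G$ satisfies $\operatorname{tw}(G) \le 4$. This bound is tight: the complete graph $K_5$ is outer $2$-planar and $\operatorname{tw}(K_5) = 4$. -/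

import Mathlib

universe u

/-- A tree decomposition of a graph `G`: a finite tree `tree` whose nodes `i : ι` carry bags
`bag i` of vertices of `G`, such that the bags cover the vertices, every edge lies in some bag,
and, for every vertex `v`, the nodes whose bags contain `v` induce a subtree. -/
structure TreeDecomposition {V : Type u} (G : SimpleGraph V) where
  ι : Type
  [fintypeι : Fintype ι]
  tree : SimpleGraph ι
  isTree : tree.IsTree
  bag : ι → Finset V
  vertex_mem : ∀ v : V, ∃ i, v ∈ bag i
  edge_mem : ∀ v w : V, G.Adj v w → ∃ i, v ∈ bag i ∧ w ∈ bag i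
  subtree : ∀ v : V, (tree.induce {i | v ∈ bag i}).Connected

attribute [instance] TreeDecomposition.fintypeι

/-- The width of a tree decomposition: the maximum size of a bag, minus one (an integer, so that
the width is `-1` if all the bags are empty). -/
def TreeDecomposition.width {V : Type u} {G : SimpleGraph V} (D : TreeDecomposition G) : ℤ :=
  ((Finset.univ.sup fun i => (D.bag i).card : ℕ) : ℤ) - 1

/-- The treewidth of a finite graph: the minimum width over all its tree decompositions. -/
noncomputable def treewidth {V : Type u} [Finite V] (G : SimpleGraph V) : ℤ :=
  sInf (Set.range fun D : TreeDecomposition G => D.width)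

/-- The minimum in the definition of the treewidth is attained: the set of widths is non-empty and
bounded below. -/
theorem isLeast_treewidth {V : Type u} [Finite V] (G : SimpleGraph V) :
    IsLeast (Set.range fun D : TreeDecomposition G => D.width) (treewidth G) := by
  have hne : (Set.range fun D : TreeDecomposition G => D.width).Nonempty := by
    have := Fintype.ofFinite V
    refine ⟨_, ⟨{ ι := Unit
                  tree := ⊥
                  isTree := SimpleGraph.IsTree.of_subsingleton
                  bag := fun _ => Finset.univ
                  vertex_mem := fun v => ⟨(), Finset.mem_univ v⟩
                  edge_mem := fun v w _ => ⟨(), Finset.mem_univ v, Finset.mem_univ w⟩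
                  subtree := fun v => ?_ }, rfl⟩⟩
    have : Nonempty ↑{i : Unit | v ∈ (fun _ => (Finset.univ : Finset V)) i} :=
      ⟨⟨(), Finset.mem_univ v⟩⟩
    exact SimpleGraph.IsTree.of_subsingleton.connected
  have hbd : BddBelow (Set.range fun D : TreeDecomposition G => D.width) := by
    refine ⟨-1, ?_⟩
    rintro _ ⟨D, rfl⟩
    simp only [TreeDecomposition.width]
    omega
  exact ⟨Int.csInf_mem hne hbd, fun x hx => csInf_le hbd hx⟩

/-- The Euclidean plane. -/
abbrev Plane : Type := EuclideanSpace ℝ (Fin 2)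

/-- A convex drawing of a graph with vertex set `V`: the vertices are placed on different points
of a circle; every edge is drawn as the straight-line segment between its endpoints. -/
structure ConvexDrawing (V : Type u) where
  center : Plane
  radius : ℝ
  radius_pos : 0 < radius
  pos : V → Plane
  pos_mem : ∀ v, pos v ∈ Metric.sphere center radius
  pos_injective : Function.Injective pos

/-- The straight-line segment, without its endpoints, that represents the vertex pair `e`. -/
def ConvexDrawing.openEdge {V : Type u} (Γ : ConvexDrawing V) (e : Sym2 V) : Set Plane :=
  Sym2.lift ⟨fun v w => openSegment ℝ (Γ.pos v) (Γ.pos w),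
    fun v w => openSegment_symm ℝ (Γ.pos v) (Γ.pos w)⟩ e

/-- Two different edges cross in a drawing if their segments have a common interior point. -/
def ConvexDrawing.Crosses {V : Type u} (Γ : ConvexDrawing V) (e f : Sym2 V) : Prop :=
  e ≠ f ∧ (Γ.openEdge e ∩ Γ.openEdge f).Nonempty

/-- An outer `k`-planar drawing of `G`: a convex drawing such that every edge of `G` crosses at
most `k` other edges of `G`. -/
def ConvexDrawing.IsOuterKPlanar {V : Type u} (Γ : ConvexDrawing V) (k : ℕ)
    (G : SimpleGraph V) : Prop :=
  ∀ e ∈ G.edgeSet, {f ∈ G.edgeSet | Γ.Crosses e f}.encard ≤ k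

/-- A graph is outer `k`-planar if it admits an outer `k`-planar drawing. -/
def OuterKPlanar {V : Type u} (k : ℕ) (G : SimpleGraph V) : Prop :=
  ∃ Γ : ConvexDrawing V, Γ.IsOuterKPlanar k G

/-!
Order the vertices by their angles on the circle. Two edges of a convex drawing cross exactly if
their endpoints alternate in this order, so crossings become a combinatorial matter.

For the upper bound, sweep over chords `[a, b]` that are left by at most two edges, all but at most
one of which cross at most one edge within `[a, b]` besides the edge `ab` itself. Such a chord has
an apex `c` for which the bag consisting of `a`, `c`, `b` and one endpoint of each edge that leaves
`[a, b]` elsewhere than at `c` or passes over `c` has at most five vertices. The apex can be chosen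
as the end of an edge that leaves the open interval and crosses all edges passing over `c`, unless
there are none of these. So each of them has room for only one more crossing, and both `[a, c]` and
`[c, b]` are again of the same kind. The decomposition of `[a, c]` is attached to the bag directly,
that of `[c, b]` via bags in which the right endpoints of the edges passing over `c` are exchanged,
one at a time, for their left endpoints.

For the lower bound, suppose that every bag misses a vertex of a clique. Let each node point to the
neighbor in the direction of the subtree of such a missing vertex. As a tree has more nodes than
edges, two adjacent nodes point to each other, and then the subtrees of the two corresponding clique
vertices are disjoint.
-/

section RootedDecompositions

open SimpleGraph

theorem isTree_sum_sup_edge {ι κ : Type*} [Finite ι] [Finite κ] {S : SimpleGraph ι}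
    {T : SimpleGraph κ} (hS : S.IsTree) (hT : T.IsTree) (i : ι) (j : κ) :
    (S.sum T ⊔ edge (.inl i) (.inr j)).IsTree := by
  classical
  rw [isTree_iff_connected_and_card] at hS hT ⊢
  refine ⟨hS.1.sum_sup_edge hT.1, ?_⟩
  have card_sum : Nat.card (S.sum T).edgeSet = Nat.card S.edgeSet + Nat.card T.edgeSet := by
    rw [Nat.card_congr edgeSetSumEquiv, Nat.card_sum]
  have edgeSet_eq : (S.sum T ⊔ edge (.inl i) (.inr j)).edgeSet
      = insert s(.inl i, .inr j) (S.sum T).edgeSet := by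
    rw [edgeSet_sup, edgeSet_edge_of_ne (by simp), Set.union_comm, Set.insert_eq]
  have new_edge : s(.inl i, .inr j) ∉ (S.sum T).edgeSet := by simp
  rw [edgeSet_eq, Nat.card_coe_set_eq, Set.ncard_insert_of_notMem new_edge,
    ← Nat.card_coe_set_eq, card_sum, Nat.card_sum]
  omega

theorem preconnected_induce_sum_sup_edge {ι κ : Type*} {S : SimpleGraph ι} {T : SimpleGraph κ}
    {i : ι} {j : κ} {A : Set (ι ⊕ κ)}
    (hS : (S.induce (Sum.inl ⁻¹' A)).Preconnected) (hT : (T.induce (Sum.inr ⁻¹' A)).Preconnected)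
    (hA : ∀ x y, .inl x ∈ A → .inr y ∈ A → .inl i ∈ A ∧ .inr j ∈ A) :
    ((S.sum T ⊔ edge (.inl i) (.inr j)).induce A).Preconnected := by
  let inl : S.induce (Sum.inl ⁻¹' A) →g (S.sum T ⊔ edge (.inl i) (.inr j)).induce A :=
    ⟨fun x => ⟨.inl x.1, x.2⟩, fun {x y} h => Or.inl (by simpa using h)⟩
  let inr : T.induce (Sum.inr ⁻¹' A) →g (S.sum T ⊔ edge (.inl i) (.inr j)).induce A :=
    ⟨fun x => ⟨.inr x.1, x.2⟩, fun {x y} h => Or.inl (by simpa using h)⟩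
  have reachable_inl_inr : ∀ x y (hx : .inl x ∈ A) (hy : .inr y ∈ A),
      ((S.sum T ⊔ edge (.inl i) (.inr j)).induce A).Reachable ⟨.inl x, hx⟩ ⟨.inr y, hy⟩ := by
    intro x y hx hy
    obtain ⟨hi, hj⟩ := hA x y hx hy
    have adj : ((S.sum T ⊔ edge (.inl i) (.inr j)).induce A).Adj ⟨.inl i, hi⟩ ⟨.inr j, hj⟩ :=
      Or.inr (by simp [edge_adj])
    exact (((hS ⟨x, hx⟩ ⟨i, hi⟩).map inl).trans adj.reachable).trans
      ((hT ⟨j, hj⟩ ⟨y, hy⟩).map inr)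
  rintro ⟨x | x, hx⟩ ⟨y | y, hy⟩
  · exact (hS ⟨x, hx⟩ ⟨y, hy⟩).map inl
  · exact reachable_inl_inr x y hx hy
  · exact (reachable_inl_inr y x hy hx).symm
  · exact (hT ⟨x, hx⟩ ⟨y, hy⟩).map inr

variable {α : Type*} {ι κ : Type*}

/-- The bags `bag i` at the nodes `i` of `T` form a tree decomposition of the vertex set `W` that
covers the vertex pairs in `E`. Unlike `TreeDecomposition`, it does not refer to a graph, so that
decompositions of overlapping parts of a graph can be combined. -/
structure IsTreeDecomp (T : SimpleGraph ι) (bag : ι → Set α) (W : Set α) (E : Set (Sym2 α)) :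
    Prop where
  isTree : T.IsTree
  iUnion_bag : ⋃ i, bag i = W
  exists_mem_sym2 : ∀ e ∈ E, ∃ i, e ∈ (bag i).sym2
  preconnected : ∀ x, (T.induce {i | x ∈ bag i}).Preconnected

theorem IsTreeDecomp.glue [Finite ι] [Finite κ] {S : SimpleGraph ι} {T : SimpleGraph κ}
    {bag₁ : ι → Set α} {bag₂ : κ → Set α} {W₁ W₂ : Set α} {E₁ E₂ : Set (Sym2 α)}
    (h₁ : IsTreeDecomp S bag₁ W₁ E₁) (h₂ : IsTreeDecomp T bag₂ W₂ E₂) {i : ι} {j : κ}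
    (hW : W₁ ∩ W₂ ⊆ bag₁ i ∩ bag₂ j) :
    IsTreeDecomp (S.sum T ⊔ edge (.inl i) (.inr j)) (Sum.elim bag₁ bag₂) (W₁ ∪ W₂) (E₁ ∪ E₂) where
  isTree := isTree_sum_sup_edge h₁.isTree h₂.isTree i j
  iUnion_bag := by rw [Set.iUnion_sum, ← h₁.iUnion_bag, ← h₂.iUnion_bag]; rfl
  exists_mem_sym2 := by
    rintro e (he | he)
    · exact (h₁.exists_mem_sym2 e he).imp' Sum.inl fun _ => id
    · exact (h₂.exists_mem_sym2 e he).imp' Sum.inr fun _ => id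
  preconnected x := by
    refine preconnected_induce_sum_sup_edge (h₁.preconnected x) (h₂.preconnected x) ?_
    exact fun p q hp hq =>
      hW ⟨h₁.iUnion_bag ▸ Set.mem_iUnion_of_mem p hp, h₂.iUnion_bag ▸ Set.mem_iUnion_of_mem q hq⟩

/-- There is a tree decomposition of the vertex set `W` into bags of at most `k` vertices that
covers the vertex pairs in `E` and has the bag `B`, its root. -/
def HasRootedDecomp (k : ℕ∞) (W : Set α) (E : Set (Sym2 α)) (B : Set α) : Prop :=
  ∃ (ι : Type) (_ : Finite ι) (T : SimpleGraph ι) (bag : ι → Set α) (r : ι),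
    IsTreeDecomp T bag W E ∧ bag r = B ∧ ∀ i, (bag i).encard ≤ k

namespace HasRootedDecomp

variable {k : ℕ∞} {W W₁ W₂ B B₁ B₂ B' : Set α} {E E₁ E₂ E' : Set (Sym2 α)}

theorem mono (h : HasRootedDecomp k W E B) (hE : E' ⊆ E) : HasRootedDecomp k W E' B := by
  obtain ⟨ι, _, T, bag, r, hT, hr⟩ := h
  exact ⟨ι, ‹_›, T, bag, r, { hT with exists_mem_sym2 := fun e he => hT.exists_mem_sym2 e (hE he) },
    hr⟩

theorem single (hB : B.encard ≤ k) : HasRootedDecomp k B B.sym2 B :=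
  ⟨Unit, inferInstance, ⊥, fun _ => B, (),
    { isTree := IsTree.of_subsingleton
      iUnion_bag := Set.iUnion_const B
      exists_mem_sym2 := fun _ he => ⟨(), he⟩
      preconnected := fun _ => Preconnected.of_subsingleton }, rfl, fun _ => hB⟩

theorem root_subset (h : HasRootedDecomp k W E B) : B ⊆ W := by
  obtain ⟨ι, _, T, bag, r, hT, rfl, -⟩ := h
  exact hT.iUnion_bag ▸ Set.subset_iUnion bag r

theorem glue (h₁ : HasRootedDecomp k W₁ E₁ B₁) (h₂ : HasRootedDecomp k W₂ E₂ B₂)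
    (hW : W₁ ∩ W₂ ⊆ B₁ ∩ B₂) : HasRootedDecomp k (W₁ ∪ W₂) (E₁ ∪ E₂) B₁ := by
  obtain ⟨ι, _, S, bag₁, i, hS, rfl, hk₁⟩ := h₁
  obtain ⟨κ, _, T, bag₂, j, hT, rfl, hk₂⟩ := h₂
  exact ⟨ι ⊕ κ, inferInstance, _, _, .inl i, hS.glue hT hW, rfl,
    Sum.forall.2 ⟨hk₁, hk₂⟩⟩

theorem extend (h : HasRootedDecomp k W E B) (hB' : B'.encard ≤ k) (hW : B' ∩ W ⊆ B) :
    HasRootedDecomp k (B' ∪ W) (B'.sym2 ∪ E) B' :=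
  (single hB').glue h (Set.subset_inter Set.inter_subset_left hW)

theorem shrink_root (h : HasRootedDecomp k W E B) (hB' : B' ⊆ B) : HasRootedDecomp k W E B' := by
  have hk : B'.encard ≤ k := by
    obtain ⟨ι, _, T, bag, r, -, rfl, hk⟩ := h
    exact (Set.encard_le_encard hB').trans (hk r)
  have := h.extend hk (Set.inter_subset_left.trans hB')
  rw [Set.union_eq_right.2 (hB'.trans h.root_subset)] at this
  exact this.mono Set.subset_union_right

theorem exchange_one {S : Set α} {x y : α} (h : HasRootedDecomp k W E (insert x S))
    (hy : y ∈ W → y ∈ S) (hk : S.encard + 2 ≤ k) :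
    HasRootedDecomp k (insert y W) (insert s(x, y) E) (insert y S) := by
  have hcard : (insert y (insert x S)).encard ≤ k :=
    calc (insert y (insert x S)).encard ≤ S.encard + 1 + 1 :=
          (Set.encard_insert_le _ _).trans (by gcongr; exact Set.encard_insert_le _ _)
      _ = S.encard + 2 := by rw [add_assoc, one_add_one_eq_two]
      _ ≤ k := hk
  -- Between the bags with `x` and with `y`, there is a bag with both; it covers the pair of them.
  have extended := h.extend hcard <| by
    rintro z ⟨rfl | hz, hzW⟩
    · exact Or.inr (hy hzW)
    · exact hz
  rw [Set.insert_union, Set.union_eq_right.2 h.root_subset] at extended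
  refine (extended.mono ?_).shrink_root (Set.insert_subset_insert (Set.subset_insert x S))
  exact Set.insert_subset (Or.inl (by simp)) Set.subset_union_right

theorem exchange {S : Set α} {X : Set (α × α)} (hX : X.Finite)
    (h : HasRootedDecomp k W E (S ∪ Prod.fst '' X)) (hW : ∀ e ∈ X, e.2 ∉ W)
    (hk : S.encard + X.encard + 1 ≤ k) :
    HasRootedDecomp k (W ∪ Prod.snd '' X) (E ∪ (fun e => s(e.1, e.2)) '' X)
      (S ∪ Prod.snd '' X) := by
  induction X, hX using Set.Finite.induction_on generalizing S with
  | empty => simpa using h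
  | @insert e X heX _ ih =>
    rw [Set.encard_insert_of_notMem heX] at hk
    have exchanged_rest : HasRootedDecomp k (W ∪ Prod.snd '' X)
        (E ∪ (fun e => s(e.1, e.2)) '' X) (insert e.1 (S ∪ Prod.snd '' X)) := by
      rw [← Set.insert_union]
      refine ih ?_ (fun f hf => hW f (Set.mem_insert_of_mem e hf)) ?_
      · rwa [Set.image_insert_eq, Set.union_insert, ← Set.insert_union] at h
      · calc (insert e.1 S).encard + X.encard + 1 ≤ S.encard + 1 + X.encard + 1 := by
              gcongr; exact Set.encard_insert_le S e.1
          _ = S.encard + (X.encard + 1) + 1 := by ring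
          _ ≤ k := hk
    simp only [Set.image_insert_eq, Set.union_insert]
    refine exchanged_rest.exchange_one ?_ ?_
    · exact fun h => Or.inr (h.resolve_left (hW e (Set.mem_insert e X)))
    · calc (S ∪ Prod.snd '' X).encard + 2 ≤ S.encard + X.encard + 2 := by
            gcongr
            exact (Set.encard_union_le _ _).trans (by gcongr; exact Set.encard_image_le _ _)
        _ = S.encard + (X.encard + 1) + 1 := by ring
        _ ≤ k := hk

theorem treewidth_le {V : Type*} [Finite V] {G : SimpleGraph V} {k : ℕ} {B : Set V}
    (h : HasRootedDecomp (k + 1) Set.univ G.edgeSet B) : treewidth G ≤ k := by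
  obtain ⟨ι, _, T, bag, r, hT, -, hk⟩ := h
  have := Fintype.ofFinite ι
  let D : TreeDecomposition G :=
    { ι := ι
      tree := T
      isTree := hT.isTree
      bag := fun i => (bag i).toFinite.toFinset
      vertex_mem := fun v => by
        simpa using hT.iUnion_bag.ge (Set.mem_univ v)
      edge_mem := fun v w hvw => by simpa using hT.exists_mem_sym2 s(v, w) hvw
      subtree := fun v => by
        have hne : {i | v ∈ bag i}.Nonempty := by
          simpa [Set.Nonempty] using hT.iUnion_bag.ge (Set.mem_univ v)
        have : Nonempty {i | v ∈ bag i} := hne.to_subtype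
        have nodes_eq : {i | v ∈ (bag i).toFinite.toFinset} = {i | v ∈ bag i} := by simp
        rw [nodes_eq]
        exact ⟨hT.preconnected v⟩ }
  have width_le : D.width ≤ k := by
    have (i : ι) : (D.bag i).card ≤ k + 1 := by
      exact_mod_cast (bag i).toFinite.encard_eq_coe_toFinset_card ▸ hk i
    have hsup : (Finset.univ.sup fun i => (D.bag i).card) ≤ k + 1 :=
      Finset.sup_le fun i _ => this i
    rw [TreeDecomposition.width]
    omega
  exact ((isLeast_treewidth G).2 ⟨D, rfl⟩).trans width_le

end HasRootedDecomp

end RootedDecompositions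

section Chords

open Set SimpleGraph

variable {α : Type*} [LinearOrder α]

/-- The endpoints of two vertex pairs alternate in the order of the vertices. For vertices ordered
along a circle, this is how the crossing of two chords is encoded. -/
def Interlace (e f : Sym2 α) : Prop :=
  ∃ u v w x, u < v ∧ v < w ∧ w < x ∧
    (e = s(u, w) ∧ f = s(v, x) ∨ e = s(v, x) ∧ f = s(u, w))

theorem interlace_mk_iff {e : Sym2 α} {p t : α} (hpt : p < t) :
    Interlace e s(p, t) ↔ ∃ x ∈ Ioo p t, ∃ y ∉ Icc p t, e = s(x, y) := by
  constructor
  · rintro ⟨u, v, w, x, huv, hvw, hwx, ⟨rfl, hf⟩ | ⟨rfl, hf⟩⟩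
    · obtain ⟨rfl, rfl⟩ | ⟨rfl, rfl⟩ := Sym2.eq_iff.1 hf
      · exact ⟨w, ⟨hvw, hwx⟩, u, fun h => huv.not_ge h.1, Sym2.eq_swap⟩
      · exact absurd (hvw.trans hwx) hpt.not_gt
    · obtain ⟨rfl, rfl⟩ | ⟨rfl, rfl⟩ := Sym2.eq_iff.1 hf
      · exact ⟨v, ⟨huv, hvw⟩, x, fun h => hwx.not_ge h.2, rfl⟩
      · exact absurd (huv.trans hvw) hpt.not_gt
  · rintro ⟨x, hx, y, hy, rfl⟩
    obtain hyp | hty : y < p ∨ t < y := by simpa [imp_iff_not_or] using hy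
    · exact ⟨y, p, x, t, hyp, hx.1, hx.2, .inl ⟨Sym2.eq_swap, rfl⟩⟩
    · exact ⟨p, x, t, y, hx.1, hx.2, hty, .inr ⟨rfl, rfl⟩⟩

theorem Interlace.symm {e f : Sym2 α} (h : Interlace e f) : Interlace f e := by
  obtain ⟨u, v, w, x, huv, hvw, hwx, h⟩ := h
  exact ⟨u, v, w, x, huv, hvw, hwx, h.symm.imp And.symm And.symm⟩

theorem Interlace.ne {e f : Sym2 α} (h : Interlace e f) : e ≠ f := by
  obtain ⟨u, v, w, x, huv, hvw, hwx, ⟨rfl, rfl⟩ | ⟨rfl, rfl⟩⟩ := h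
  · simp [huv.ne, (huv.trans (hvw.trans hwx)).ne]
  · simp [huv.ne', hvw.ne]

/-- The edges of `G` that interlace the vertex pair `e`. -/
def interlacingEdges (G : SimpleGraph α) (e : Sym2 α) : Set (Sym2 α) :=
  {f ∈ G.edgeSet | Interlace e f}

/-- The edges of `G` with exactly one endpoint strictly between `a` and `b` and the other outside
`[a, b]`, oriented so that the inner endpoint comes first. -/
def outgoingEdges (G : SimpleGraph α) (a b : α) : Set (α × α) :=
  {e | G.Adj e.1 e.2 ∧ e.1 ∈ Ioo a b ∧ e.2 ∉ Icc a b}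

/-- The edges of `G` within `[a, b]` that pass over `c`, except for the edge between `a` and `b`,
oriented from left to right. -/
def edgesOver (G : SimpleGraph α) (a c b : α) : Set (α × α) :=
  {e | G.Adj e.1 e.2 ∧ e.1 ∈ Ico a c ∧ e.2 ∈ Ioc c b ∧ e ≠ (a, b)}

variable {G : SimpleGraph α} {a b c x y : α} {Z : Set (α × α)}

theorem image_subset_interlacingEdges
    (hZ : ∀ e ∈ Z, G.Adj e.1 e.2 ∧ x ∈ Ioo e.1 e.2 ∧ y ∉ Icc e.1 e.2) :
    (fun e => s(e.1, e.2)) '' Z ⊆ interlacingEdges G s(x, y) := by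
  rintro _ ⟨e, he, rfl⟩
  obtain ⟨hadj, hx, hy⟩ := hZ e he
  exact ⟨hadj, (interlace_mk_iff (hx.1.trans hx.2)).2 ⟨x, hx, y, hy, rfl⟩⟩

theorem encard_image_mk_of_lt (hZ : ∀ e ∈ Z, e.1 < e.2) :
    ((fun e => s(e.1, e.2)) '' Z).encard = Z.encard := by
  refine InjOn.encard_image fun e he f hf h => ?_
  obtain ⟨h₁, h₂⟩ | ⟨h₁, h₂⟩ := Sym2.eq_iff.1 h
  · exact Prod.ext h₁ h₂
  · exact absurd (hZ e he) (by rw [h₁, h₂]; exact (hZ f hf).not_gt)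

theorem encard_le_encard_interlacingEdges
    (hZ : ∀ e ∈ Z, G.Adj e.1 e.2 ∧ x ∈ Ioo e.1 e.2 ∧ y ∉ Icc e.1 e.2) :
    Z.encard ≤ (interlacingEdges G s(x, y)).encard := by
  rw [← encard_image_mk_of_lt fun e he => (hZ e he).2.1.1.trans (hZ e he).2.1.2]
  exact encard_le_encard (image_subset_interlacingEdges hZ)

theorem subsingleton_of_mem_interlacingEdges
    (hZ : ∀ e ∈ Z, G.Adj e.1 e.2 ∧ x ∈ Ioo e.1 e.2 ∧ y ∉ Icc e.1 e.2)
    (hxy : (interlacingEdges G s(x, y)).encard ≤ 2) {f : Sym2 α}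
    (hf : f ∈ interlacingEdges G s(x, y)) (hfZ : ∀ e ∈ Z, s(e.1, e.2) ≠ f) : Z.Subsingleton := by
  have hf_notMem : f ∉ (fun e => s(e.1, e.2)) '' Z := by rintro ⟨e, he, rfl⟩; exact hfZ e he rfl
  have hcard := encard_le_encard (insert_subset hf (image_subset_interlacingEdges hZ))
  rw [encard_insert_of_notMem hf_notMem,
    encard_image_mk_of_lt fun e he => (hZ e he).2.1.1.trans (hZ e he).2.1.2] at hcard
  have : Z.encard + 1 ≤ 1 + 1 := hcard.trans hxy
  exact encard_le_one_iff_subsingleton.1 (by simpa using this)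

theorem edgesOver_interlaces {e : α × α} (hy : y ∉ Icc a b) (he : e ∈ edgesOver G a x b) :
    G.Adj e.1 e.2 ∧ x ∈ Ioo e.1 e.2 ∧ y ∉ Icc e.1 e.2 :=
  ⟨he.1, ⟨he.2.1.2, he.2.2.1.1⟩, fun h => hy ⟨he.2.1.1.trans h.1, h.2.trans he.2.2.1.2⟩⟩

theorem exists_subsingleton_diff_singleton {β : Type*} [Nonempty β] {S A B : Set β} (hS : S ⊆ A ∪ B)
    (hA : A.Subsingleton) (hAB : A.encard + B.encard ≤ 2) :
    ∃ g, (S \ {g}).Subsingleton ∧ S \ {g} ⊆ B := by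
  obtain rfl | ⟨z, rfl⟩ := hA.eq_empty_or_singleton
  · rw [empty_union] at hS
    rw [encard_empty, zero_add] at hAB
    obtain rfl | ⟨g, hg⟩ := S.eq_empty_or_nonempty
    · exact ⟨Classical.arbitrary β, by simp, by simp⟩
    · have hcard : (S \ {g}).encard + 1 ≤ 1 + 1 := by
        rw [encard_sdiff_singleton_add_one hg]
        exact (encard_le_encard hS).trans hAB
      exact ⟨g, encard_le_one_iff_subsingleton.1 (by simpa using hcard), sdiff_subset.trans hS⟩
  · have hB : B.encard ≤ 1 := by
      have : 1 + B.encard ≤ 1 + 1 := by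
        rwa [encard_singleton, ← one_add_one_eq_two] at hAB
      simpa using this
    have hSB : S \ {z} ⊆ B := fun x hx => (hS hx.1).resolve_left hx.2
    exact ⟨z, (encard_le_one_iff_subsingleton.1 hB).anti hSB, hSB⟩

/-- At most two edges leave the part of the graph strictly between `a` and `b`, and all of them
except possibly `g` are interlaced by at most one other edge within `[a, b]`, where the edge between
`a` and `b` does not count. -/
def GoodChord (G : SimpleGraph α) (a b : α) : Prop :=
  ∃ g, (outgoingEdges G a b \ {g}).Subsingleton ∧
    ∀ e ∈ outgoingEdges G a b \ {g}, (edgesOver G a e.1 b).Subsingleton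

/-- A vertex `c` strictly between `a` and `b` at which the chord from `a` to `b` is split into the
chords from `a` to `c` and from `c` to `b`. -/
structure IsApex (G : SimpleGraph α) (a c b : α) : Prop where
  mem_Ioo : c ∈ Ioo a b
  subsingleton : {e ∈ outgoingEdges G a b | e.1 ≠ c}.Subsingleton
  encard_le : {e ∈ outgoingEdges G a b | e.1 ≠ c}.encard + (edgesOver G a c b).encard ≤ 2
  exists_adj : ∀ e ∈ edgesOver G a c b, ∃ o ∉ Ioo a b, G.Adj c o ∧ o ∉ Icc e.1 e.2

theorem exists_isApex_of_outgoingEdges_eq_empty [Finite α]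
    (hG : ∀ e ∈ G.edgeSet, (interlacingEdges G e).encard ≤ 2) (hab : (Ioo a b).Nonempty)
    (hX : outgoingEdges G a b = ∅) : ∃ c, IsApex G a c b := by
  by_cases hne : (Ioo a b ∩ G.neighborSet a).Nonempty
  · obtain ⟨c, ⟨hc, hadj⟩, hmax⟩ := (toFinite _).exists_maximal hne
    have hover : ∀ e ∈ edgesOver G a c b, a < e.1 := by
      rintro ⟨p, t⟩ ⟨hpt, hp, ht, hne⟩
      refine hp.1.lt_of_ne ?_
      rintro rfl
      have htb : t < b := ht.2.lt_of_ne (by rintro rfl; exact hne rfl)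
      exact (hmax ⟨⟨hc.1.trans ht.1, htb⟩, hpt⟩ ht.1.le).not_gt ht.1
    have ha : ∀ e ∈ edgesOver G a c b, a ∉ Icc e.1 e.2 := fun e he h => (hover e he).not_ge h.1
    refine ⟨c, hc, by simp [hX], ?_, fun e he => ⟨a, by simp, hadj.symm, ha e he⟩⟩
    simp only [hX, mem_empty_iff_false, false_and, ofPred_false, encard_empty, zero_add]
    exact (encard_le_encard_interlacingEdges fun e he =>
      ⟨he.1, ⟨he.2.1.2, he.2.2.1.1⟩, ha e he⟩).trans (hG s(c, a) hadj.symm)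
  · obtain ⟨c, hc, hmin⟩ := (toFinite _).exists_minimal hab
    have hover : edgesOver G a c b = ∅ := by
      refine eq_empty_of_forall_notMem ?_
      rintro ⟨p, t⟩ ⟨hpt, hp, ht, hpt_ne⟩
      have hpa : p = a := hp.1.eq_of_not_lt' fun hap =>
        (hmin ⟨hap, hp.2.trans hc.2⟩ hp.2.le).not_gt hp.2
      subst hpa
      have htb : t < b := ht.2.lt_of_ne (by rintro rfl; exact hpt_ne rfl)
      exact hne ⟨t, ⟨hc.1.trans ht.1, htb⟩, hpt⟩
    exact ⟨c, hc, by simp [hX], by simp [hX, hover], by simp [hover]⟩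

theorem isApex_fst {e : α × α} (he : e ∈ outgoingEdges G a b)
    (hsub : {f ∈ outgoingEdges G a b | f.1 ≠ e.1}.Subsingleton)
    (hcard : {f ∈ outgoingEdges G a b | f.1 ≠ e.1}.encard + (edgesOver G a e.1 b).encard ≤ 2) :
    IsApex G a e.1 b :=
  ⟨he.2.1, hsub, hcard, fun _ hf => ⟨e.2, fun h => he.2.2 (Ioo_subset_Icc_self h), he.1,
    (edgesOver_interlaces he.2.2 hf).2.2⟩⟩

theorem GoodChord.exists_isApex [Finite α]
    (hG : ∀ e ∈ G.edgeSet, (interlacingEdges G e).encard ≤ 2) (hab : (Ioo a b).Nonempty)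
    (h : GoodChord G a b) : ∃ c, IsApex G a c b := by
  obtain ⟨g, hsub, hover⟩ := h
  obtain hX | ⟨e, he⟩ := (outgoingEdges G a b \ {g}).eq_empty_or_nonempty
  · by_cases hg : g ∈ outgoingEdges G a b
    · have hA : {f ∈ outgoingEdges G a b | f.1 ≠ g.1} = ∅ :=
        eq_empty_of_forall_notMem fun f hf => hX.le ⟨hf.1, fun h => hf.2 (congrArg Prod.fst h)⟩
      refine ⟨g.1, isApex_fst hg (by simp [hA]) ?_⟩
      rw [hA, encard_empty, zero_add]
      exact (encard_le_encard_interlacingEdges fun _ => edgesOver_interlaces hg.2.2).trans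
        (hG s(g.1, g.2) hg.1)
    · rw [sdiff_singleton_eq_self hg] at hX
      exact exists_isApex_of_outgoingEdges_eq_empty hG hab hX
  · have hA : {f ∈ outgoingEdges G a b | f.1 ≠ e.1} ⊆ {g} := fun f hf =>
      by_contra fun hfg => hf.2 (congrArg Prod.fst (hsub ⟨hf.1, hfg⟩ he))
    refine ⟨e.1, isApex_fst he.1 (subsingleton_singleton.anti hA) ?_⟩
    calc {f ∈ outgoingEdges G a b | f.1 ≠ e.1}.encard + (edgesOver G a e.1 b).encard
        ≤ 1 + 1 := by
          gcongr
          · exact (encard_le_encard hA).trans (encard_singleton g).le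
          · exact encard_le_one_iff_subsingleton.2 (hover e he)
      _ = 2 := one_add_one_eq_two

namespace IsApex

theorem outgoingEdges_left_subset (h : IsApex G a c b) :
    outgoingEdges G a c ⊆ {e ∈ outgoingEdges G a b | e.1 ≠ c} ∪ edgesOver G a c b := by
  rintro ⟨x, y⟩ ⟨hxy, hx, hy⟩
  by_cases hyb : y ∈ Icc a b
  · have hcy : c < y := by simpa [hyb.1] using hy
    exact Or.inr ⟨hxy, Ioo_subset_Ico_self hx, ⟨hcy, hyb.2⟩,
      fun he => hx.1.ne' (Prod.ext_iff.1 he).1⟩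
  · exact Or.inl ⟨⟨hxy, Ioo_subset_Ioo_right h.mem_Ioo.2.le hx, hyb⟩, hx.2.ne⟩

theorem outgoingEdges_right_subset (h : IsApex G a c b) :
    outgoingEdges G c b ⊆
      {e ∈ outgoingEdges G a b | e.1 ≠ c} ∪ Prod.swap ⁻¹' edgesOver G a c b := by
  rintro ⟨x, y⟩ ⟨hxy, hx, hy⟩
  by_cases hyb : y ∈ Icc a b
  · have hyc : y < c := by simpa [hyb.2] using hy
    exact Or.inr ⟨hxy.symm, ⟨hyb.1, hyc⟩, Ioo_subset_Ioc_self hx,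
      fun he => hx.2.ne (Prod.ext_iff.1 he).2⟩
  · exact Or.inl ⟨⟨hxy, Ioo_subset_Ioo_left h.mem_Ioo.1.le hx, hyb⟩, hx.1.ne'⟩

theorem encard_outgoingEdges_right_le (h : IsApex G a c b) :
    (outgoingEdges G c b).encard ≤ 2 :=
  calc (outgoingEdges G c b).encard
      ≤ {e ∈ outgoingEdges G a b | e.1 ≠ c}.encard + (Prod.swap ⁻¹' edgesOver G a c b).encard :=
        (encard_le_encard h.outgoingEdges_right_subset).trans (encard_union_le _ _)
    _ = {e ∈ outgoingEdges G a b | e.1 ≠ c}.encard + (edgesOver G a c b).encard := by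
        rw [encard_preimage_of_bijective Prod.swap_bijective]
    _ ≤ 2 := h.encard_le

theorem exists_mem_interlacingEdges (h : IsApex G a c b) {e : α × α} (he : e ∈ edgesOver G a c b) :
    ∃ o ∉ Ioo a b, s(c, o) ∈ interlacingEdges G s(e.1, e.2) := by
  obtain ⟨o, ho, hco, hoe⟩ := h.exists_adj e he
  have hc : c ∈ Ioo e.1 e.2 := ⟨he.2.1.2, he.2.2.1.1⟩
  exact ⟨o, ho, hco, ((interlace_mk_iff (hc.1.trans hc.2)).2 ⟨c, hc, o, hoe, rfl⟩).symm⟩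

theorem goodChord_left (hG : ∀ e ∈ G.edgeSet, (interlacingEdges G e).encard ≤ 2)
    (h : IsApex G a c b) : GoodChord G a c := by
  have : Nonempty (α × α) := ⟨(a, b)⟩
  obtain ⟨g, hsub, hg⟩ :=
    exists_subsingleton_diff_singleton h.outgoingEdges_left_subset h.subsingleton h.encard_le
  refine ⟨g, hsub, fun e he => ?_⟩
  -- The edge from `c` to `o` crosses `e` but does not count, since it either leaves `[a, c]` or is
  -- the edge between `a` and `c`. So only one crossing of `e` is left.
  obtain ⟨o, ho, hco⟩ := h.exists_mem_interlacingEdges (hg he)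
  refine subsingleton_of_mem_interlacingEdges (fun _ => edgesOver_interlaces he.1.2.2)
    (hG s(e.1, e.2) he.1.1) hco ?_
  rintro ⟨p, t⟩ ⟨-, hp, ht, hpt_ne⟩ hpt
  obtain ⟨rfl, rfl⟩ | ⟨rfl, rfl⟩ := Sym2.eq_iff.1 hpt
  · exact hp.2.not_ge he.1.2.1.2.le
  · exact ho ⟨hp.1.lt_of_ne (by rintro rfl; exact hpt_ne rfl),
      (hp.2.trans he.1.2.1.2).trans h.mem_Ioo.2⟩

theorem goodChord_right (hG : ∀ e ∈ G.edgeSet, (interlacingEdges G e).encard ≤ 2)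
    (h : IsApex G a c b) : GoodChord G c b := by
  have : Nonempty (α × α) := ⟨(a, b)⟩
  obtain ⟨g, hsub, hg⟩ := exists_subsingleton_diff_singleton h.outgoingEdges_right_subset
    h.subsingleton (by rw [encard_preimage_of_bijective Prod.swap_bijective]; exact h.encard_le)
  refine ⟨g, hsub, fun e he => ?_⟩
  obtain ⟨o, ho, hco⟩ := h.exists_mem_interlacingEdges (hg he)
  refine subsingleton_of_mem_interlacingEdges (fun _ => edgesOver_interlaces he.1.2.2)
    (hG s(e.1, e.2) he.1.1) (by rwa [Sym2.eq_swap (a := e.1)]) ?_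
  rintro ⟨p, t⟩ ⟨-, hp, ht, hpt_ne⟩ hpt
  obtain ⟨rfl, rfl⟩ | ⟨rfl, rfl⟩ := Sym2.eq_iff.1 hpt
  · exact ho ⟨(h.mem_Ioo.1.trans he.1.2.1.1).trans ht.1,
      ht.2.lt_of_ne (by rintro rfl; exact hpt_ne rfl)⟩
  · exact ht.1.not_gt he.1.2.1.1

end IsApex

/-- The part of `G` within `[a, b]` has a tree decomposition with bags of size at most five whose
root contains `a`, `b` and the inner endpoints of the outgoing edges. -/
def HasChordDecomp (G : SimpleGraph α) (a b : α) : Prop :=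
  HasRootedDecomp 5 (Icc a b) (G.edgeSet ∩ (Icc a b).sym2)
    ({a, b} ∪ Prod.fst '' outgoingEdges G a b)

/-- The bag for the triangle on `a`, `c` and `b`. Besides these vertices, it contains one endpoint
of every edge that leaves `[a, b]` or passes over `c`. -/
def triangleBag (G : SimpleGraph α) (a c b : α) : Set α :=
  {a, c, b} ∪ Prod.fst '' ({e ∈ outgoingEdges G a b | e.1 ≠ c} ∪ edgesOver G a c b)

/-- The edges between the parts strictly on either side of `c`, oriented from right to left. -/
def bridgingEdges (G : SimpleGraph α) (a c b : α) : Set (α × α) :=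
  {e ∈ outgoingEdges G c b | e.2 ∈ Ico a c}

namespace IsApex

theorem encard_triangleBag_le (h : IsApex G a c b) : (triangleBag G a c b).encard ≤ 5 := by
  have hvertices : ({a, c, b} : Set α).encard ≤ 3 :=
    calc ({a, c, b} : Set α).encard ≤ ({b} : Set α).encard + 1 + 1 :=
          (encard_insert_le _ _).trans (by gcongr; exact encard_insert_le _ _)
      _ = 3 := by rw [encard_singleton]; norm_num
  calc (triangleBag G a c b).encard
      ≤ ({a, c, b} : Set α).encard +
          ({e ∈ outgoingEdges G a b | e.1 ≠ c} ∪ edgesOver G a c b).encard :=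
        (encard_union_le _ _).trans (by gcongr; exact encard_image_le _ _)
    _ ≤ 3 + 2 := by
        gcongr
        exact (encard_union_le _ _).trans h.encard_le
    _ = 5 := by norm_num

theorem triangleBag_subset (h : IsApex G a c b) : triangleBag G a c b ⊆ Icc a b := by
  have hac := h.mem_Ioo.1
  have hcb := h.mem_Ioo.2
  rintro x (hx | ⟨e, he | he, rfl⟩)
  · obtain rfl | rfl | rfl := hx
    exacts [left_mem_Icc.2 (hac.trans hcb).le, ⟨hac.le, hcb.le⟩, right_mem_Icc.2 (hac.trans hcb).le]
  · exact Ioo_subset_Icc_self he.1.2.1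
  · exact ⟨he.2.1.1, he.2.1.2.le.trans hcb.le⟩

theorem root_subset_triangleBag :
    {a, b} ∪ Prod.fst '' outgoingEdges G a b ⊆ triangleBag G a c b := by
  rintro x ((rfl | rfl) | ⟨e, he, rfl⟩)
  · simp [triangleBag]
  · simp [triangleBag]
  · by_cases hec : e.1 = c
    · simp [triangleBag, hec]
    · exact Or.inr ⟨e, Or.inl ⟨he, hec⟩, rfl⟩

theorem triangleBag_inter_left_subset (h : IsApex G a c b) :
    triangleBag G a c b ∩ Icc a c ⊆ {a, c} ∪ Prod.fst '' outgoingEdges G a c := by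
  rintro x ⟨hx, hax, hxc⟩
  by_cases hroot : x = a ∨ x = c
  · exact Or.inl hroot
  obtain ⟨hxa, hxc_ne⟩ := not_or.1 hroot
  have hx_mem : x ∈ Ioo a c := ⟨hax.lt_of_ne' hxa, hxc.lt_of_ne hxc_ne⟩
  obtain hx | ⟨e, he | he, rfl⟩ := hx
  · obtain rfl | rfl | rfl := hx
    exacts [absurd rfl hxa, absurd rfl hxc_ne, absurd h.mem_Ioo.2 hxc.not_gt]
  · exact Or.inr ⟨e, ⟨he.1.1, hx_mem, fun h' => he.1.2.2 (Icc_subset_Icc_right h.mem_Ioo.2.le h')⟩,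
      rfl⟩
  · exact Or.inr ⟨e, ⟨he.1, hx_mem, fun h' => he.2.2.1.1.not_ge h'.2⟩, rfl⟩

theorem triangleBag_inter_right_subset (h : IsApex G a c b) :
    triangleBag G a c b ∩ Icc c b ⊆
      {c, b} ∪ Prod.fst '' (outgoingEdges G c b \ bridgingEdges G a c b) := by
  rintro x ⟨hx, hcx, hxb⟩
  obtain hx | ⟨e, he | he, rfl⟩ := hx
  · obtain rfl | rfl | rfl := hx
    exacts [absurd h.mem_Ioo.1 hcx.not_gt, Or.inl (Or.inl rfl), Or.inl (Or.inr rfl)]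
  · refine Or.inr ⟨e, ⟨⟨he.1.1, ⟨hcx.lt_of_ne' he.2, he.1.2.1.2⟩, ?_⟩, ?_⟩, rfl⟩
    · exact fun h' => he.1.2.2 (Icc_subset_Icc_left h.mem_Ioo.1.le h')
    · exact fun h' => he.1.2.2 ⟨h'.2.1, h'.2.2.le.trans h.mem_Ioo.2.le⟩
  · exact absurd he.2.1.2 hcx.not_gt

theorem snd_image_bridgingEdges_subset :
    Prod.snd '' bridgingEdges G a c b ⊆ triangleBag G a c b := by
  rintro _ ⟨e, ⟨he, hleft⟩, rfl⟩
  exact Or.inr ⟨e.swap, Or.inr ⟨he.1.symm, hleft, Ioo_subset_Ioc_self he.2.1,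
    fun h => he.2.1.2.ne (Prod.ext_iff.1 h).2⟩, rfl⟩

theorem hasRootedDecomp_left (h : IsApex G a c b) (hleft : HasChordDecomp G a c) :
    HasRootedDecomp 5 (triangleBag G a c b ∪ Icc a c)
      ((triangleBag G a c b).sym2 ∪ G.edgeSet ∩ (Icc a c).sym2) (triangleBag G a c b) :=
  hleft.extend h.encard_triangleBag_le h.triangleBag_inter_left_subset

theorem hasRootedDecomp_right [Finite α] (h : IsApex G a c b) (hright : HasChordDecomp G c b) :
    HasRootedDecomp 5 (Icc c b ∪ Prod.snd '' bridgingEdges G a c b)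
      (G.edgeSet ∩ (Icc c b).sym2 ∪ (fun e => s(e.1, e.2)) '' bridgingEdges G a c b)
      ({c, b} ∪ Prod.fst '' (outgoingEdges G c b \ bridgingEdges G a c b)
        ∪ Prod.snd '' bridgingEdges G a c b) := by
  have hsub : bridgingEdges G a c b ⊆ outgoingEdges G c b := sep_subset _ _
  refine HasRootedDecomp.exchange (toFinite _) ?_ (fun e he => he.1.2.2) ?_
  · rwa [union_assoc, ← image_union, sdiff_union_of_subset hsub]
  · calc ({c, b} ∪ Prod.fst '' (outgoingEdges G c b \ bridgingEdges G a c b)).encard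
          + (bridgingEdges G a c b).encard + 1
        ≤ 2 + (outgoingEdges G c b \ bridgingEdges G a c b).encard
          + (bridgingEdges G a c b).encard + 1 := by
          gcongr
          refine (encard_union_le _ _).trans ?_
          gcongr
          exacts [(encard_insert_le _ _).trans (by rw [encard_singleton, one_add_one_eq_two]),
            encard_image_le _ _]
      _ = 2 + (outgoingEdges G c b).encard + 1 := by
          rw [add_assoc 2, encard_sdiff_add_encard_of_subset hsub]
      _ ≤ 2 + 2 + 1 := by gcongr; exact h.encard_outgoingEdges_right_le
      _ = 5 := by norm_num

theorem edgeSet_inter_sym2_subset (h : IsApex G a c b) :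
    G.edgeSet ∩ (Icc a b).sym2 ⊆
      (triangleBag G a c b).sym2 ∪ G.edgeSet ∩ (Icc a c).sym2 ∪
        (G.edgeSet ∩ (Icc c b).sym2 ∪ (fun e => s(e.1, e.2)) '' bridgingEdges G a c b) := by
  rintro e ⟨he, hmem⟩
  induction e with | _ x y
  wlog hxy : x < y generalizing x y
  · rw [Sym2.eq_swap] at he hmem ⊢
    exact this y x he hmem ((not_lt.1 hxy).lt_of_ne he.ne)
  obtain ⟨hx, hy⟩ := mk_mem_sym2_iff.1 hmem
  obtain hyc | hcy := le_or_gt y c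
  · exact Or.inl (Or.inr ⟨he, mk_mem_sym2_iff.2 ⟨⟨hx.1, hxy.le.trans hyc⟩, ⟨hy.1, hyc⟩⟩⟩)
  obtain hcx | hxc := le_or_gt c x
  · exact Or.inr (Or.inl ⟨he, mk_mem_sym2_iff.2 ⟨⟨hcx, hx.2⟩, ⟨hcy.le, hy.2⟩⟩⟩)
  obtain hyb | rfl := hy.2.lt_or_eq
  · exact Or.inr (Or.inr ⟨(y, x), ⟨⟨he.symm, ⟨hcy, hyb⟩, fun h' => hxc.not_ge h'.1⟩, hx.1, hxc⟩,
      Sym2.eq_swap⟩)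
  refine Or.inl (Or.inl (mk_mem_sym2_iff.2 ⟨?_, by simp [triangleBag]⟩))
  obtain rfl | hax := hx.1.eq_or_lt
  · simp [triangleBag]
  · exact Or.inr ⟨(x, y), Or.inr ⟨he, ⟨hx.1, hxc⟩, ⟨hcy, le_rfl⟩,
      fun h' => hax.ne' (Prod.ext_iff.1 h').1⟩, rfl⟩

theorem hasChordDecomp [Finite α] (h : IsApex G a c b) (hleft : HasChordDecomp G a c)
    (hright : HasChordDecomp G c b) : HasChordDecomp G a b := by
  have hac := h.mem_Ioo.1.le
  have hcb := h.mem_Ioo.2.le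
  have glued := (h.hasRootedDecomp_left hleft).glue (h.hasRootedDecomp_right hright) ?_
  · have hvertices : triangleBag G a c b ∪ Icc a c
        ∪ (Icc c b ∪ Prod.snd '' bridgingEdges G a c b) = Icc a b := by
      rw [union_assoc, ← union_assoc (Icc a c), Icc_union_Icc_eq_Icc hac hcb]
      have := snd_image_bridgingEdges_subset.trans h.triangleBag_subset
      rw [union_eq_left.2 this, union_eq_right.2 h.triangleBag_subset]
    rw [hvertices] at glued
    exact (glued.mono h.edgeSet_inter_sym2_subset).shrink_root root_subset_triangleBag
  · rintro x ⟨hx₁, hx₂ | hx₂⟩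
    · have hx : x ∈ triangleBag G a c b := by
        obtain hx | hx := hx₁
        · exact hx
        · rw [le_antisymm hx.2 hx₂.1]
          simp [triangleBag]
      exact ⟨hx, Or.inl (h.triangleBag_inter_right_subset ⟨hx, hx₂⟩)⟩
    · exact ⟨snd_image_bridgingEdges_subset hx₂, Or.inr hx₂⟩

end IsApex

theorem hasChordDecomp_of_Ioo_eq_empty (hab : a ≤ b) (hempty : Ioo a b = ∅) :
    HasChordDecomp G a b := by
  have hIcc : Icc a b = {a, b} := by
    rw [← Icc_sdiff_both, sdiff_eq_empty] at hempty
    exact hempty.antisymm (pair_subset (left_mem_Icc.2 hab) (right_mem_Icc.2 hab))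
  have hout : outgoingEdges G a b = ∅ :=
    eq_empty_of_forall_notMem fun e he => hempty.le he.2.1
  rw [HasChordDecomp, hIcc, hout, image_empty, union_empty]
  refine (HasRootedDecomp.single ?_).mono inter_subset_right
  calc ({a, b} : Set α).encard ≤ ({b} : Set α).encard + 1 := encard_insert_le _ _
    _ ≤ 5 := by rw [encard_singleton]; norm_num

theorem GoodChord.hasChordDecomp [Finite α]
    (hG : ∀ e ∈ G.edgeSet, (interlacingEdges G e).encard ≤ 2) (hab : a ≤ b)
    (h : GoodChord G a b) : HasChordDecomp G a b := by
  induction hn : (Icc a b).ncard using Nat.strong_induction_on generalizing a b with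
  | _ n ih =>
    subst hn
    obtain hempty | hne := (Ioo a b).eq_empty_or_nonempty
    · exact hasChordDecomp_of_Ioo_eq_empty hab hempty
    · obtain ⟨c, hc⟩ := h.exists_isApex hG hne
      obtain ⟨hac, hcb⟩ := hc.mem_Ioo
      have hleft : (Icc a c).ncard < (Icc a b).ncard :=
        ncard_lt_ncard (Icc_ssubset_Icc_right hab le_rfl hcb)
      have hright : (Icc c b).ncard < (Icc a b).ncard :=
        ncard_lt_ncard (Icc_ssubset_Icc_left hab hac le_rfl)
      exact hc.hasChordDecomp (ih _ hleft hac.le (hc.goodChord_left hG) rfl)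
        (ih _ hright hcb.le (hc.goodChord_right hG) rfl)

theorem treewidth_le_four_of_encard_interlacingEdges_le [Finite α]
    (hG : ∀ e ∈ G.edgeSet, (interlacingEdges G e).encard ≤ 2) : treewidth G ≤ 4 := by
  suffices ∃ B, HasRootedDecomp 5 univ G.edgeSet B by
    obtain ⟨B, hB⟩ := this
    exact HasRootedDecomp.treewidth_le (k := 4) (by convert hB using 1; norm_num)
  obtain _ | _ := isEmpty_or_nonempty α
  · refine ⟨univ, (HasRootedDecomp.single ?_).mono fun e _ => ?_⟩
    · simp [univ_eq_empty_iff.2 ‹_›, -encard_univ]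
    · exact isEmptyElim e
  obtain ⟨a, ha : ∀ x, a ≤ x⟩ := Finite.exists_min (id : α → α)
  obtain ⟨b, hb : ∀ x, x ≤ b⟩ := Finite.exists_max (id : α → α)
  have hIcc : Icc a b = univ := eq_univ_of_forall fun x => ⟨ha x, hb x⟩
  have hout : outgoingEdges G a b = ∅ :=
    eq_empty_of_forall_notMem fun e he => he.2.2 (by simp [hIcc])
  have good : GoodChord G a b := ⟨(a, b), by simp [hout], by simp [hout]⟩
  have hdecomp := good.hasChordDecomp hG (ha b)
  rw [HasChordDecomp, hIcc, sym2_univ, inter_univ] at hdecomp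
  exact ⟨_, hdecomp⟩

end Chords

section Circle

open Real Set

theorem sign_sin_half {x : ℝ} (hx : |x| < 2 * π) :
    SignType.sign (sin (x / 2)) = SignType.sign x := by
  obtain ⟨hlt, hgt⟩ := abs_lt.1 hx
  obtain hneg | rfl | hpos := lt_trichotomy x 0
  · rw [sign_neg hneg, sign_neg (sin_neg_of_neg_of_neg_pi_lt (by linarith) (by linarith))]
  · simp
  · rw [sign_pos hpos, sign_pos (sin_pos_of_pos_of_lt_pi (by linarith) (by linarith))]

/-- Twice the signed area of the triangle whose corners are the points of the unit circle with
angles `α`, `β` and `γ`. -/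
noncomputable def circleArea (α β γ : ℝ) : ℝ :=
  sin (β - α) + sin (γ - β) - sin (γ - α)

theorem circleArea_eq_mul (α β γ : ℝ) :
    circleArea α β γ = 4 * sin ((β - α) / 2) * sin ((γ - β) / 2) * sin ((γ - α) / 2) := by
  obtain ⟨x, rfl⟩ : ∃ x, β = α + 2 * x := ⟨(β - α) / 2, by ring⟩
  obtain ⟨y, rfl⟩ : ∃ y, γ = α + 2 * x + 2 * y := ⟨(γ - (α + 2 * x)) / 2, by ring⟩
  rw [circleArea, show α + 2 * x + 2 * y - α = 2 * (x + y) by ring]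
  simp only [add_sub_cancel_left, mul_div_cancel_left₀ _ (two_ne_zero' ℝ), sin_two_mul, sin_add,
    cos_add]
  linear_combination (-2 * sin y * cos y) * cos_sq' x + (-2 * sin x * cos x) * cos_sq' y

section Sign

variable {α β γ : ℝ} (hα : α ∈ Ioc (-π) π) (hβ : β ∈ Ioc (-π) π) (hγ : γ ∈ Ioc (-π) π)
  (hαβ : α < β)

include hα hβ hγ hαβ

theorem sign_circleArea :
    SignType.sign (circleArea α β γ) = SignType.sign ((γ - β) * (γ - α)) := by
  have abs_sub_lt {x y : ℝ} (hx : x ∈ Ioc (-π) π) (hy : y ∈ Ioc (-π) π) : |x - y| < 2 * π :=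
    abs_lt.2 ⟨by linarith [hx.1, hy.2], by linarith [hx.2, hy.1]⟩
  rw [circleArea_eq_mul, sign_mul, sign_mul, sign_mul, sign_sin_half (abs_sub_lt hβ hα),
    sign_sin_half (abs_sub_lt hγ hβ), sign_sin_half (abs_sub_lt hγ hα), sign_mul,
    sign_pos four_pos, sign_pos (sub_pos.2 hαβ), one_mul, one_mul]

theorem circleArea_neg_iff : circleArea α β γ < 0 ↔ γ ∈ Ioo α β := by
  rw [← sign_eq_neg_one_iff, sign_circleArea hα hβ hγ hαβ, sign_eq_neg_one_iff, mul_neg_iff]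
  simp only [sub_pos, sub_neg, mem_Ioo]
  constructor
  · rintro (h | h)
    · exact absurd (h.1.trans h.2) hαβ.not_gt
    · exact h.symm
  · exact fun h => Or.inr h.symm

theorem circleArea_pos_iff : 0 < circleArea α β γ ↔ γ ∉ Icc α β := by
  rw [← sign_eq_one_iff, sign_circleArea hα hβ hγ hαβ, sign_eq_one_iff, mul_pos_iff]
  simp only [sub_pos, sub_neg, mem_Icc, not_and_or, not_le]
  constructor
  · exact fun h => h.symm.imp And.right And.left
  · exact fun h => h.symm.imp (fun h => ⟨h, hαβ.trans h⟩) fun h => ⟨h.trans hαβ, h⟩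

end Sign

/-- The point at angle `θ` on the circle with center `c` and radius `r`. -/
noncomputable def circlePoint (c : Plane) (r θ : ℝ) : Plane :=
  c + r • !₂[cos θ, sin θ]

variable {c : Plane} {r α β γ δ : ℝ}

theorem circlePoint_apply_zero (c : Plane) (r θ : ℝ) : circlePoint c r θ 0 = c 0 + r * cos θ := rfl

theorem circlePoint_apply_one (c : Plane) (r θ : ℝ) : circlePoint c r θ 1 = c 1 + r * sin θ := rfl

/-- The affine dependence between four points of a circle: the coefficient of each point is the area
of the triangle formed by the other three. -/
theorem circleArea_smul_add_smul (c : Plane) (r α β γ δ : ℝ) :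
    circleArea β γ δ • circlePoint c r α + circleArea α β δ • circlePoint c r γ
      = circleArea α γ δ • circlePoint c r β + circleArea α β γ • circlePoint c r δ := by
  ext i
  fin_cases i
  · simp only [circleArea, sin_sub, Fin.zero_eta, PiLp.add_apply, PiLp.smul_apply, smul_eq_mul,
      circlePoint_apply_zero]
    ring
  · simp only [circleArea, sin_sub, Fin.mk_one, PiLp.add_apply, PiLp.smul_apply, smul_eq_mul,
      circlePoint_apply_one]
    ring

theorem circleArea_add (α β γ δ : ℝ) :
    circleArea β γ δ + circleArea α β δ = circleArea α γ δ + circleArea α β γ := by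
  simp only [circleArea]
  ring

theorem openSegment_inter_openSegment_nonempty {E : Type*} [AddCommGroup E] [Module ℝ E]
    {P Q R S : E} {a b c d : ℝ} (ha : 0 < a) (hb : 0 < b) (hc : 0 < c) (hd : 0 < d)
    (hsum : a + b = c + d) (h : a • P + b • R = c • Q + d • S) :
    (openSegment ℝ P R ∩ openSegment ℝ Q S).Nonempty := by
  refine ⟨(a / (a + b)) • P + (b / (a + b)) • R,
    ⟨a / (a + b), b / (a + b), by positivity, by positivity, by field_simp, rfl⟩,
    ⟨c / (a + b), d / (a + b), by positivity, by positivity, by rw [hsum]; field_simp, ?_⟩⟩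
  simp only [div_eq_inv_mul, mul_smul, ← smul_add, h]

theorem chords_inter_nonempty_of_alternating (hα : -π < α) (hδ : δ ≤ π) (hαβ : α < β) (hβγ : β < γ)
    (hγδ : γ < δ) :
    (openSegment ℝ (circlePoint c r α) (circlePoint c r γ) ∩
      openSegment ℝ (circlePoint c r β) (circlePoint c r δ)).Nonempty := by
  have circleArea_pos {x y z : ℝ} (hx : α ≤ x) (hxy : x < y) (hyz : y < z) (hz : z ≤ δ) :
      0 < circleArea x y z :=
    (circleArea_pos_iff ⟨by linarith, by linarith⟩ ⟨by linarith, by linarith⟩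
      ⟨by linarith, by linarith⟩ hxy).2 fun h => hyz.not_ge h.2
  exact openSegment_inter_openSegment_nonempty
    (circleArea_pos hαβ.le hβγ hγδ le_rfl) (circleArea_pos le_rfl hαβ (hβγ.trans hγδ) le_rfl)
    (circleArea_pos le_rfl (hαβ.trans hβγ) hγδ le_rfl) (circleArea_pos le_rfl hαβ hβγ hγδ.le)
    (circleArea_add α β γ δ) (circleArea_smul_add_smul c r α β γ δ)

theorem exists_circleArea_combination_eq_zero (hr : r ≠ 0)
    (h : (openSegment ℝ (circlePoint c r α) (circlePoint c r β) ∩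
      openSegment ℝ (circlePoint c r γ) (circlePoint c r δ)).Nonempty) :
    ∃ s t : ℝ, 0 < s ∧ 0 < t ∧ s * circleArea α β γ + t * circleArea α β δ = 0 := by
  obtain ⟨z, ⟨p, q, -, -, hpq, rfl⟩, s, t, hs, ht, hst, h⟩ := h
  refine ⟨s, t, hs, ht, ?_⟩
  -- The area is an affine function of the third corner and vanishes on the chord from `α` to `β`.
  have hcos : s * cos γ + t * cos δ = p * cos α + q * cos β := by
    have := congrArg (· 0) h
    simp only [PiLp.add_apply, PiLp.smul_apply, smul_eq_mul, circlePoint_apply_zero] at this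
    refine mul_left_cancel₀ hr ?_
    linear_combination this + c 0 * hpq - c 0 * hst
  have hsin : s * sin γ + t * sin δ = p * sin α + q * sin β := by
    have := congrArg (· 1) h
    simp only [PiLp.add_apply, PiLp.smul_apply, smul_eq_mul, circlePoint_apply_one] at this
    refine mul_left_cancel₀ hr ?_
    linear_combination this + c 1 * hpq - c 1 * hst
  simp only [circleArea, sin_sub]
  linear_combination (cos β - cos α) * hsin - (sin β - sin α) * hcos
    + (cos α * sin β - cos β * sin α) * (hst - hpq)

theorem alternating_or_subset_of_chords_inter_nonempty (hr : r ≠ 0)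
    (hα : α ∈ Ioc (-π) π) (hβ : β ∈ Ioc (-π) π) (hγ : γ ∈ Ioc (-π) π) (hδ : δ ∈ Ioc (-π) π)
    (hαβ : α < β) (h : (openSegment ℝ (circlePoint c r α) (circlePoint c r β) ∩
      openSegment ℝ (circlePoint c r γ) (circlePoint c r δ)).Nonempty) :
    γ ∈ Ioo α β ∧ δ ∉ Icc α β ∨ δ ∈ Ioo α β ∧ γ ∉ Icc α β ∨ {γ, δ} ⊆ ({α, β} : Set ℝ) := by
  obtain ⟨s, t, hs, ht, hst⟩ := exists_circleArea_combination_eq_zero hr h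
  have mem_pair_of_eq_zero {θ : ℝ} (hθ : θ ∈ Ioc (-π) π) (hzero : circleArea α β θ = 0) :
      θ ∈ ({α, β} : Set ℝ) := by
    rw [← Icc_sdiff_Ioo_same hαβ.le]
    exact ⟨not_not.1 fun h' => ((circleArea_pos_iff hα hβ hθ hαβ).2 h').ne' hzero,
      fun h' => ((circleArea_neg_iff hα hβ hθ hαβ).2 h').ne hzero⟩
  obtain hneg | hzero | hpos := lt_trichotomy (circleArea α β γ) 0
  · have hδ_pos : 0 < circleArea α β δ := by nlinarith
    exact Or.inl ⟨(circleArea_neg_iff hα hβ hγ hαβ).1 hneg,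
      (circleArea_pos_iff hα hβ hδ hαβ).1 hδ_pos⟩
  · have hδ_zero : circleArea α β δ = 0 := by simpa [hzero, ht.ne'] using hst
    exact Or.inr (Or.inr (pair_subset (mem_pair_of_eq_zero hγ hzero)
      (mem_pair_of_eq_zero hδ hδ_zero)))
  · have hδ_neg : circleArea α β δ < 0 := by nlinarith
    exact Or.inr (Or.inl ⟨(circleArea_neg_iff hα hβ hδ hαβ).1 hδ_neg,
      (circleArea_pos_iff hα hβ hγ hαβ).1 hpos⟩)

end Circle

section Drawings

open Real Set SimpleGraph

variable {V : Type u}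

namespace ConvexDrawing

variable (Γ : ConvexDrawing V)

/-- The angle in `(-π, π]` at which a vertex is seen from the center of the circle. -/
noncomputable def angle (v : V) : ℝ :=
  Complex.arg ⟨Γ.pos v 0 - Γ.center 0, Γ.pos v 1 - Γ.center 1⟩

theorem angle_mem_Ioc (v : V) : Γ.angle v ∈ Ioc (-π) π := Complex.arg_mem_Ioc _

theorem pos_eq_circlePoint (v : V) : Γ.pos v = circlePoint Γ.center Γ.radius (Γ.angle v) := by
  have hr : ‖(⟨Γ.pos v 0 - Γ.center 0, Γ.pos v 1 - Γ.center 1⟩ : ℂ)‖ = Γ.radius := by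
    have := Γ.pos_mem v
    rw [Metric.mem_sphere, EuclideanSpace.dist_eq, Fin.sum_univ_two, Real.dist_eq, Real.dist_eq,
      sq_abs, sq_abs] at this
    rw [← this, Complex.norm_def, Complex.normSq_mk, sq, sq]
  have hcos := Complex.norm_mul_cos_arg ⟨Γ.pos v 0 - Γ.center 0, Γ.pos v 1 - Γ.center 1⟩
  have hsin := Complex.norm_mul_sin_arg ⟨Γ.pos v 0 - Γ.center 0, Γ.pos v 1 - Γ.center 1⟩
  rw [hr, ← angle] at hcos hsin
  ext i
  fin_cases i
  · exact (sub_eq_iff_eq_add'.1 hcos.symm)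
  · exact (sub_eq_iff_eq_add'.1 hsin.symm)

theorem angle_injective : Function.Injective Γ.angle := fun u v h =>
  Γ.pos_injective (by rw [pos_eq_circlePoint, pos_eq_circlePoint, h])

theorem openEdge_mk (v w : V) :
    Γ.openEdge s(v, w) = openSegment ℝ (circlePoint Γ.center Γ.radius (Γ.angle v))
      (circlePoint Γ.center Γ.radius (Γ.angle w)) := by
  rw [← pos_eq_circlePoint, ← pos_eq_circlePoint]
  rfl

section AngularOrder

variable [LinearOrder V] {Γ} {e f : Sym2 V}

theorem crosses_of_interlace (hΓ : StrictMono Γ.angle) (h : Interlace e f) : Γ.Crosses e f := by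
  refine ⟨h.ne, ?_⟩
  obtain ⟨u, v, w, x, huv, hvw, hwx, h⟩ := h
  have hinter := chords_inter_nonempty_of_alternating (c := Γ.center) (r := Γ.radius)
    (Γ.angle_mem_Ioc u).1 (Γ.angle_mem_Ioc x).2 (hΓ huv) (hΓ hvw) (hΓ hwx)
  rw [← openEdge_mk, ← openEdge_mk] at hinter
  obtain ⟨rfl, rfl⟩ | ⟨rfl, rfl⟩ := h
  · exact hinter
  · rwa [inter_comm]

theorem interlace_of_crosses (hΓ : StrictMono Γ.angle) (he : ¬e.IsDiag) (hf : ¬f.IsDiag)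
    (h : Γ.Crosses e f) : Interlace e f := by
  induction e with | _ u v
  induction f with | _ w x
  wlog huv : u < v generalizing u v
  · rw [Sym2.eq_swap] at he h ⊢
    exact this v u he h ((not_lt.1 huv).lt_of_ne fun h => he h)
  obtain ⟨hne, hinter⟩ := h
  rw [openEdge_mk, openEdge_mk] at hinter
  have mem_Ioo_iff (y : V) : Γ.angle y ∈ Ioo (Γ.angle u) (Γ.angle v) ↔ y ∈ Ioo u v := by
    simp only [mem_Ioo, hΓ.lt_iff_lt]
  have mem_Icc_iff (y : V) : Γ.angle y ∈ Icc (Γ.angle u) (Γ.angle v) ↔ y ∈ Icc u v := by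
    simp only [mem_Icc, hΓ.le_iff_le]
  obtain h | h | h := alternating_or_subset_of_chords_inter_nonempty Γ.radius_pos.ne'
    (Γ.angle_mem_Ioc u) (Γ.angle_mem_Ioc v) (Γ.angle_mem_Ioc w) (Γ.angle_mem_Ioc x) (hΓ huv) hinter
  · rw [mem_Ioo_iff, mem_Icc_iff] at h
    exact ((interlace_mk_iff huv).2 ⟨w, h.1, x, h.2, rfl⟩).symm
  · rw [mem_Ioo_iff, mem_Icc_iff] at h
    exact ((interlace_mk_iff huv).2 ⟨x, h.1, w, h.2, Sym2.eq_swap⟩).symm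
  · simp only [pair_subset_iff, mem_insert_iff, mem_singleton_iff, Γ.angle_injective.eq_iff] at h
    obtain ⟨rfl | rfl, rfl | rfl⟩ := h <;> simp_all [Sym2.eq_swap]

theorem isOuterKPlanar_iff (hΓ : StrictMono Γ.angle) {k : ℕ} {G : SimpleGraph V} :
    Γ.IsOuterKPlanar k G ↔ ∀ e ∈ G.edgeSet, (interlacingEdges G e).encard ≤ k := by
  refine forall₂_congr fun e he => ?_
  have crosses_iff : {f ∈ G.edgeSet | Γ.Crosses e f} = interlacingEdges G e := by
    ext f
    exact and_congr_right fun hf => ⟨interlace_of_crosses hΓ (G.not_isDiag_of_mem_edgeSet he)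
      (G.not_isDiag_of_mem_edgeSet hf), crosses_of_interlace hΓ⟩
  rw [crosses_iff]

end AngularOrder

theorem nonempty_of_countable [Countable V] : Nonempty (ConvexDrawing V) := by
  obtain ⟨f, hf⟩ := exists_injective_nat V
  have angle_mem (n : ℕ) : (1 : ℝ) / (n + 1) ∈ Icc 0 π :=
    ⟨by positivity, (div_le_one_of_le₀ (by simp) (by positivity)).trans (by linarith [pi_gt_three])⟩
  exact ⟨{
    center := 0
    radius := 1
    radius_pos := one_pos
    pos := fun v => circlePoint 0 1 (1 / (f v + 1))
    pos_mem := fun v => by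
      simp [EuclideanSpace.norm_eq, Fin.sum_univ_two, circlePoint_apply_zero, circlePoint_apply_one]
    pos_injective := fun v w h => by
      have hcos := congrArg (· 0) h
      simp only [circlePoint_apply_zero, add_right_inj, one_mul] at hcos
      have hangle := injOn_cos (angle_mem (f v)) (angle_mem (f w)) hcos
      refine hf ?_
      simpa using hangle }⟩

end ConvexDrawing

theorem treewidth_le_four_of_outerKPlanar_two [Finite V] {G : SimpleGraph V}
    (h : OuterKPlanar 2 G) : treewidth G ≤ 4 := by
  obtain ⟨Γ, hΓ⟩ := h
  let _ : LinearOrder V := LinearOrder.lift' Γ.angle Γ.angle_injective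
  have angle_strictMono : StrictMono Γ.angle := fun _ _ => id
  exact treewidth_le_four_of_encard_interlacingEdges_le
    ((ConvexDrawing.isOuterKPlanar_iff angle_strictMono).1 hΓ)

theorem encard_interlacingEdges_le_two [Finite V] [LinearOrder V] (hV : Nat.card V ≤ 5)
    {G : SimpleGraph V} {e : Sym2 V} (he : ¬e.IsDiag) : (interlacingEdges G e).encard ≤ 2 := by
  induction e with | _ u v
  wlog huv : u < v generalizing u v
  · rw [Sym2.eq_swap] at he ⊢
    exact this v u he ((not_lt.1 huv).lt_of_ne fun h => he h)
  have hsub : interlacingEdges G s(u, v) ⊆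
      (fun p => s(p.1, p.2)) '' Ioo u v ×ˢ (Icc u v)ᶜ := by
    rintro f ⟨-, hf⟩
    obtain ⟨x, hx, y, hy, rfl⟩ := (interlace_mk_iff huv).1 hf.symm
    exact ⟨(x, y), ⟨hx, hy⟩, rfl⟩
  have hcard : (Ioo u v).ncard + 2 + (Icc u v)ᶜ.ncard ≤ 5 :=
    calc (Ioo u v).ncard + 2 + (Icc u v)ᶜ.ncard = (Icc u v).ncard + (Icc u v)ᶜ.ncard := by
          rw [← ncard_sdiff_add_ncard_of_subset (Ioo_subset_Icc_self (a := u) (b := v)),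
            Icc_sdiff_Ioo_same huv.le, ncard_pair huv.ne, add_comm 2]
      _ = Nat.card V := ncard_add_ncard_compl _
      _ ≤ 5 := hV
  have hmul : (Ioo u v).ncard * (Icc u v)ᶜ.ncard ≤ 2 := by
    have hIoo : (Ioo u v).ncard ≤ 3 := by omega
    interval_cases (Ioo u v).ncard <;> omega
  calc (interlacingEdges G s(u, v)).encard
      ≤ (Ioo u v ×ˢ (Icc u v)ᶜ).encard := (encard_le_encard hsub).trans (encard_image_le _ _)
    _ = ((Ioo u v).ncard * (Icc u v)ᶜ.ncard : ℕ) := by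
      rw [encard_prod, Nat.cast_mul, (toFinite _).cast_ncard_eq, (toFinite _).cast_ncard_eq]
    _ ≤ 2 := by exact_mod_cast hmul

theorem outerKPlanar_two_of_card_le_five [Finite V] (hV : Nat.card V ≤ 5) (G : SimpleGraph V) :
    OuterKPlanar 2 G := by
  obtain ⟨Γ⟩ := ConvexDrawing.nonempty_of_countable (V := V)
  let _ : LinearOrder V := LinearOrder.lift' Γ.angle Γ.angle_injective
  have angle_strictMono : StrictMono Γ.angle := fun _ _ => id
  exact ⟨Γ, (ConvexDrawing.isOuterKPlanar_iff angle_strictMono).2 fun e he =>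
    encard_interlacingEdges_le_two hV (G.not_isDiag_of_mem_edgeSet he)⟩

end Drawings

section Cliques

open SimpleGraph

theorem exists_apply_apply_eq_of_isTree {ι : Type*} [Finite ι] {T : SimpleGraph ι} (hT : T.IsTree)
    {f : ι → ι} (hf : ∀ i, T.Adj i (f i)) : ∃ i, f (f i) = i := by
  have hcard : Nat.card T.edgeSet + 1 = Nat.card ι := (isTree_iff_connected_and_card.1 hT).2
  -- A tree has fewer edges than nodes, so two nodes `i` choose the same edge `s(i, f i)`.
  let edge : ι → T.edgeSet := fun i => ⟨s(i, f i), hf i⟩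
  have not_injective : ¬Function.Injective edge := fun h => by
    have := Nat.card_le_card_of_injective edge h
    omega
  obtain ⟨i, j, hij, hne⟩ := Function.not_injective_iff.1 not_injective
  obtain ⟨h, -⟩ | ⟨h₁, h₂⟩ := Sym2.eq_iff.1 (congrArg Subtype.val hij)
  · exact absurd h hne
  · exact ⟨i, by rw [h₂, ← h₁]⟩

theorem reachable_deleteEdges_of_notMem_support {ι : Type*} {T : SimpleGraph ι} {x y i : ι}
    (p : T.Walk x y) (hi : i ∉ p.support) (j : ι) : (T.deleteEdges {s(i, j)}).Reachable x y :=
  ⟨p.toDeleteEdge s(i, j) fun h => hi (p.fst_mem_support_of_mem_edges h)⟩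

theorem exists_adj_forall_reachable_deleteEdges {ι : Type*} {T : SimpleGraph ι}
    (hT : T.Preconnected) {A : Set ι} (hA : (T.induce A).Connected) {i : ι} (hi : i ∉ A) :
    ∃ j, T.Adj i j ∧ ∀ z ∈ A, (T.deleteEdges {s(i, j)}).Reachable j z := by
  obtain ⟨t, ht⟩ := hA.nonempty
  obtain ⟨p, hp⟩ := (hT i t).exists_isPath
  cases p with
  | nil => exact absurd ht hi
  | @cons _ j _ hij q =>
    rw [Walk.cons_isPath_iff] at hp
    refine ⟨j, hij, fun z hz => (reachable_deleteEdges_of_notMem_support q hp.2 j).trans ?_⟩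
    obtain ⟨w⟩ := hA.preconnected ⟨t, ht⟩ ⟨z, hz⟩
    refine reachable_deleteEdges_of_notMem_support (w.map (Embedding.induce A).toHom) ?_ j
    rw [Walk.support_map, List.mem_map]
    rintro ⟨x, -, rfl⟩
    exact hi x.2

variable {V : Type u} {G : SimpleGraph V}

theorem TreeDecomposition.exists_subset_bag_of_isClique (D : TreeDecomposition G) {s : Set V}
    (hs : G.IsClique s) : ∃ i, s ⊆ D.bag i := by
  by_contra! hno
  simp only [Set.not_subset] at hno
  choose v hvs hv using hno
  choose f hadj hreach using fun i => exists_adj_forall_reachable_deleteEdges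
    D.isTree.connected.preconnected (D.subtree (v i)) (hv i)
  obtain ⟨i, hi⟩ := exists_apply_apply_eq_of_isTree D.isTree hadj
  obtain ⟨z, hz₁, hz₂⟩ : ∃ z, v i ∈ D.bag z ∧ v (f i) ∈ D.bag z := by
    by_cases h : v i = v (f i)
    · exact (D.vertex_mem (v i)).imp fun z hz => ⟨hz, h ▸ hz⟩
    · exact D.edge_mem _ _ (hs (hvs i) (hvs (f i)) h)
  have reachable_fst : (D.tree.deleteEdges {s(i, f i)}).Reachable i z := by
    have := hreach (f i) z hz₂
    rwa [hi, Sym2.eq_swap] at this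
  have hbridge := isAcyclic_iff_forall_adj_isBridge.1 D.isTree.isAcyclic (hadj i)
  exact (isBridge_iff.1 hbridge) (reachable_fst.trans (hreach i z hz₁).symm)

theorem card_sub_one_le_treewidth_of_isClique [Finite V] {s : Finset V} (hs : G.IsClique s) :
    (s.card : ℤ) - 1 ≤ treewidth G := by
  obtain ⟨D, hD : D.width = treewidth G⟩ := (isLeast_treewidth G).1
  obtain ⟨i, hi⟩ := D.exists_subset_bag_of_isClique hs
  have hcard : s.card ≤ Finset.univ.sup fun i => (D.bag i).card :=
    (Finset.card_le_card hi).trans <|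
      Finset.le_sup (f := fun i => (D.bag i).card) (Finset.mem_univ i)
  rw [← hD, TreeDecomposition.width]
  omega

end Cliques

theorem mainTheorem2 :
    (∀ (V : Type u) [Finite V] (G : SimpleGraph V), OuterKPlanar 2 G → treewidth G ≤ 4) ∧
    OuterKPlanar 2 (SimpleGraph.completeGraph (Fin 5)) ∧
    treewidth (SimpleGraph.completeGraph (Fin 5)) = 4 := by
  have outer_two_planar : OuterKPlanar 2 (SimpleGraph.completeGraph (Fin 5)) :=
    outerKPlanar_two_of_card_le_five (by simp) _
  have isClique_univ :
      (SimpleGraph.completeGraph (Fin 5)).IsClique (Finset.univ : Finset (Fin 5)) :=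
    fun _ _ _ _ hne => hne
  refine ⟨fun V _ G => treewidth_le_four_of_outerKPlanar_two, outer_two_planar, ?_⟩
  refine le_antisymm (treewidth_le_four_of_outerKPlanar_two outer_two_planar) ?_
  simpa using card_sub_one_le_treewidth_of_isClique isClique_univ
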